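/- Let $K$ be a field and let $Q$ be a finite, connected, acyclic quiver with $n$ vertices, $Q\neq\vec A_1$ (where $\vec A_1$ is the quiver with a single vertex and no arrows; acyclic means without oriented cycles). Let $A=KQ/\mathcal I$ be a bound quiver algebra of $Q$, i.e. $KQ$ is the path algebra of $Q$ and $\mathcal I$ is an admissible ideal: a two-sided ideal with $R^m\subseteq\mathcal I\subseteq R^2$ for some $m\geq 2$, where $R$ is the two-sided ideal of $KQ$ generated by the arrows. Write $\operatorname{dom.dim}A$ for the dominant dimension of $A$, i.e. the supremum in $\mathbb N\cup\{\infty\}$ of all $t\geq 0$ for which the left regular module ${}_AA$ has a minimal injective resolution $0\to A\to I_1\to I_2\to\cdots$ in which $I_1,\dots,I_t$ are projective (so $\operatorname{dom.dim}A=0$ if the injective envelope of ${}_AA$ is not projective). Let $d$ be the number of isomorphism classes of indecomposable left $A$-modules that are both projective and injective. Then $$\operatorname{dom.dim}A\;\leq\; d\;\leq\; n-1 .$$ In particular $\operatorname{dom.dim}A$ is finite. -/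

import Mathlib

open CategoryTheory

namespace QuiverAlg

section Quiver

variable (V : Type*) [Quiver V]

/-- A quiver is connected if it is non-empty and its underlying undirected graph is connected. -/
def IsConnected : Prop :=
  Nonempty V ∧ Subsingleton (Quiver.WeaklyConnectedComponent V)

/-- A quiver is acyclic if it has no oriented cycle, i.e. no closed path of positive length. -/
def IsAcyclic : Prop :=
  ∀ (a : V) (p : Quiver.Path a a), p.length = 0

/-- The quiver with a single vertex and no arrows. -/
def IsPoint : Prop :=
  Nat.card V = 1 ∧ ∀ a b : V, IsEmpty (a ⟶ b)

/-- All paths of the quiver: a triple of a source, a target and a path between them. -/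
abbrev AllPath := Σ a b : V, Quiver.Path a b

end Quiver

/-- The path algebra: the `k`-vector space with basis the set of all paths, including the
trivial path at every vertex. -/
def PathAlgebra (k : Type*) [Field k] (V : Type*) [Quiver V] : Type _ :=
  AllPath V →₀ k

namespace PathAlgebra

variable {k : Type*} [Field k] {V : Type*} [Quiver V]

noncomputable instance : AddCommGroup (PathAlgebra k V) :=
  inferInstanceAs (AddCommGroup (AllPath V →₀ k))

noncomputable instance : Module k (PathAlgebra k V) :=
  inferInstanceAs (Module k (AllPath V →₀ k))

variable (k V) in
/-- The basis of the path algebra consisting of the paths. -/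
noncomputable def pathBasis : Module.Basis (AllPath V) k (PathAlgebra k V) :=
  Finsupp.basisSingleOne (R := k) (ι := AllPath V)

variable (k) in
/-- The basis element of the path algebra given by a path. -/
noncomputable def ofPath {a b : V} (p : Quiver.Path a b) : PathAlgebra k V :=
  pathBasis k V ⟨a, b, p⟩

open scoped Classical in
variable (k) in
/-- The product of two basis elements: `p * q` is the path "first `q`, then `p`" if `q` ends where
`p` starts, and zero otherwise. With this convention the left ideal generated by the trivial path
at `a` is spanned by the paths starting at `a`. -/
noncomputable def mulBasis (p q : AllPath V) : PathAlgebra k V :=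
  if h : q.2.1 = p.1 then ofPath k (q.2.2.comp (p.2.2.cast h.symm rfl)) else 0

variable (k V) in
/-- The multiplication of the path algebra, extended bilinearly from the basis. -/
noncomputable def mulLin : PathAlgebra k V →ₗ[k] PathAlgebra k V →ₗ[k] PathAlgebra k V :=
  (pathBasis k V).constr k fun p => (pathBasis k V).constr k fun q => mulBasis k p q

noncomputable instance : Mul (PathAlgebra k V) := ⟨fun f g => mulLin k V f g⟩

/-- The unit is the sum of the trivial paths. -/
noncomputable instance [Fintype V] : One (PathAlgebra k V) :=
  ⟨∑ a : V, ofPath k (Quiver.Path.nil : Quiver.Path a a)⟩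

theorem mul_def (f g : PathAlgebra k V) : f * g = mulLin k V f g := rfl

theorem one_def [Fintype V] :
    (1 : PathAlgebra k V) = ∑ a : V, ofPath k (Quiver.Path.nil : Quiver.Path a a) := rfl

theorem mulLin_ofPath {a b c d : V} (p : Quiver.Path a b) (q : Quiver.Path c d) :
    mulLin k V (ofPath k p) (ofPath k q) = mulBasis k ⟨a, b, p⟩ ⟨c, d, q⟩ := by
  simp only [mulLin, ofPath, Module.Basis.constr_basis]

theorem ofPath_mul_ofPath {a b c : V} (p : Quiver.Path b c) (q : Quiver.Path a b) :
    ofPath k p * ofPath k q = ofPath k (q.comp p) := by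
  rw [mul_def, mulLin_ofPath]
  simp [mulBasis]

theorem ofPath_mul_ofPath_of_ne {a b c d : V} (p : Quiver.Path c d) (q : Quiver.Path a b)
    (h : b ≠ c) : ofPath k p * ofPath k q = 0 := by
  rw [mul_def, mulLin_ofPath]
  simp [mulBasis, h]

@[elab_as_elim]
theorem induction_on {P : PathAlgebra k V → Prop} (f : PathAlgebra k V) (zero : P 0)
    (add : ∀ f g, P f → P g → P (f + g))
    (smul : ∀ (r : k) {a b : V} (p : Quiver.Path a b), P (r • ofPath k p)) : P f := by
  rw [← (pathBasis k V).linearCombination_repr f, Finsupp.linearCombination_apply, Finsupp.sum]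
  exact Finset.sum_induction _ P add zero fun p _ => smul _ p.2.2

theorem mul_assoc_aux (f g h : PathAlgebra k V) : f * g * h = f * (g * h) := by
  simp only [mul_def]
  induction f using induction_on with
  | zero => simp
  | add f f' hf hf' => simp [hf, hf']
  | smul r p =>
  induction g using induction_on with
  | zero => simp
  | add f f' hf hf' => simp only [map_add, LinearMap.add_apply, hf, hf']
  | smul s q =>
  induction h using induction_on with
  | zero => simp
  | add f f' hf hf' => simp only [map_add, hf, hf']
  | smul t u =>
  rename_i a b c d e f
  simp only [map_smul, LinearMap.smul_apply, ← mul_def]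
  congr 3
  by_cases h1 : d = a
  · subst h1
    rw [ofPath_mul_ofPath]
    by_cases h2 : f = c
    · subst h2
      rw [ofPath_mul_ofPath, ofPath_mul_ofPath, ofPath_mul_ofPath, Quiver.Path.comp_assoc]
    · rw [ofPath_mul_ofPath_of_ne _ _ h2, ofPath_mul_ofPath_of_ne _ _ h2, mul_def, map_zero]
  · rw [ofPath_mul_ofPath_of_ne _ _ h1]
    by_cases h2 : f = c
    · subst h2
      rw [ofPath_mul_ofPath, ofPath_mul_ofPath_of_ne _ _ h1, mul_def, map_zero,
        LinearMap.zero_apply]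
    · rw [ofPath_mul_ofPath_of_ne _ _ h2, mul_def, map_zero, LinearMap.zero_apply, mul_def,
        map_zero]

theorem one_mul_aux [Fintype V] (f : PathAlgebra k V) : 1 * f = f := by
  rw [mul_def]
  induction f using induction_on with
  | zero => simp
  | add f g hf hg => rw [map_add, hf, hg]
  | smul r p =>
  rename_i a b
  rw [map_smul, one_def, map_sum, LinearMap.sum_apply, Finset.sum_eq_single b]
  · rw [← mul_def, ofPath_mul_ofPath, Quiver.Path.comp_nil]
  · intro c _ hc
    rw [← mul_def, ofPath_mul_ofPath_of_ne _ _ hc.symm]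
  · simp

theorem mul_one_aux [Fintype V] (f : PathAlgebra k V) : f * 1 = f := by
  rw [mul_def]
  induction f using induction_on with
  | zero => simp
  | add f g hf hg => rw [map_add, LinearMap.add_apply, hf, hg]
  | smul r p =>
  rename_i a b
  rw [map_smul, LinearMap.smul_apply, one_def, map_sum, Finset.sum_eq_single a]
  · rw [← mul_def, ofPath_mul_ofPath, Quiver.Path.nil_comp]
  · intro c _ hc
    rw [← mul_def, ofPath_mul_ofPath_of_ne _ _ hc]
  · simp

noncomputable instance [Fintype V] : Ring (PathAlgebra k V) where
  __ := (inferInstance : AddCommGroup (PathAlgebra k V))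
  mul f g := f * g
  one := 1
  mul_assoc := mul_assoc_aux
  one_mul := one_mul_aux
  mul_one := mul_one_aux
  left_distrib f g h := map_add (mulLin k V f) g h
  right_distrib f g h := by
    change mulLin k V (f + g) h = mulLin k V f h + mulLin k V g h
    rw [map_add, LinearMap.add_apply]
  zero_mul f := by
    change mulLin k V 0 f = 0
    rw [map_zero, LinearMap.zero_apply]
  mul_zero f := map_zero (mulLin k V f)

noncomputable instance [Fintype V] : Algebra k (PathAlgebra k V) :=
  Algebra.ofModule
    (fun r f g => by
      change mulLin k V (r • f) g = r • mulLin k V f g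
      rw [map_smul, LinearMap.smul_apply])
    (fun r f g => map_smul (mulLin k V f) r g)

end PathAlgebra

section Admissible

variable (k : Type*) [Field k] (V : Type*) [Quiver V] [Fintype V]

/-- The arrow ideal: the two-sided ideal of the path algebra generated by the arrows. -/
noncomputable def arrowIdeal : Ideal (PathAlgebra k V) :=
  (TwoSidedIdeal.span
    {x : PathAlgebra k V | ∃ (a b : V) (e : a ⟶ b), x = PathAlgebra.ofPath k e.toPath}).asIdeal

variable {k V}

/-- An ideal `I` of the path algebra is admissible if `R ^ m ≤ I ≤ R ^ 2` for some `m ≥ 2`, where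
`R` is the arrow ideal. The quotient by an admissible two-sided ideal is a bound quiver algebra. -/
def IsAdmissible (I : Ideal (PathAlgebra k V)) : Prop :=
  I ≤ arrowIdeal k V ^ 2 ∧ ∃ m : ℕ, 2 ≤ m ∧ arrowIdeal k V ^ m ≤ I

end Admissible

universe u

section Modules

variable (A : Type u) [Ring A]

/-- A submodule is essential if it meets every non-zero submodule non-trivially. -/
def IsEssential {A : Type*} [Ring A] {M : Type*} [AddCommGroup M] [Module A M]
    (N : Submodule A M) : Prop :=
  ∀ L : Submodule A M, N ⊓ L = ⊥ → L = ⊥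

/-- A minimal injective resolution `0 → M → I 0 → I 1 → I 2 → ⋯` of a left module `M`: an exact
sequence with injective terms such that `I 0` is an injective envelope of `M` and `I (j + 1)` is
an injective envelope of the image of `I j → I (j + 1)`, i.e. of the cokernel of the preceding
map. -/
structure MinInjResolution (M : Type u) [AddCommGroup M] [Module A M] where
  /-- the terms of the resolution -/
  I : ℕ → ModuleCat.{u} A
  /-- the augmentation -/
  ε : M →ₗ[A] I 0
  /-- the differentials -/
  d : ∀ j, I j →ₗ[A] I (j + 1)
  injective : ∀ j, Module.Injective A (I j)
  exact_left : Function.Injective ε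
  exact_zero : Function.Exact ε (d 0)
  exact_succ : ∀ j, Function.Exact (d j) (d (j + 1))
  essential_zero : IsEssential (LinearMap.range ε)
  essential_succ : ∀ j, IsEssential (LinearMap.range (d j))

/-- `dom.dim M ≥ n`: there is a minimal injective resolution of `M` whose first `n` terms are
projective (hence projective-injective). -/
def DomDimGE (M : Type u) [AddCommGroup M] [Module A M] (n : ℕ) : Prop :=
  ∃ R : MinInjResolution A M, ∀ j < n, Module.Projective A (R.I j)

/-- The dominant dimension of a left module, with values in `ℕ ∪ {∞}`. -/
noncomputable def moduleDomDim (M : Type u) [AddCommGroup M] [Module A M] : ℕ∞ :=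
  ⨆ n : {n : ℕ // DomDimGE A M n}, ((n : ℕ) : ℕ∞)

/-- The dominant dimension of a ring is that of its left regular module. -/
noncomputable def domDim : ℕ∞ := moduleDomDim A A

/-- The number, in `ℕ ∪ {∞}`, of isomorphism classes of indecomposable left modules that are both
projective and injective. -/
noncomputable def numProjInj : ℕ∞ :=
  Set.encard {c : Quotient (isIsomorphicSetoid (ModuleCat.{u} A)) |
    ∃ M : ModuleCat.{u} A, c = Quotient.mk _ M ∧
      Indecomposable M ∧ Module.Projective A M ∧ Module.Injective A M}

end Modules

end QuiverAlg

/-! Write `B` for the quotient algebra. In an acyclic quiver, applying a path that leads to a last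
possible vertex moves any nonzero element concentrated at a vertex into the socle. So every nonzero
module contains a simple submodule spanned by a socle element at some vertex. An indecomposable
injective module is an essential extension of each of its nonzero submodules. If it is nonzero it
therefore has a single socle vertex, and that vertex determines it up to isomorphism
(`IsSocleAt.unique`, `IsSocleAt.nonempty_iso`). Thus `d` counts the vertices that occur as socles of
indecomposable projective-injectives.

For `d ≤ n - 1`: a source that emits an arrow is never in the socle of a projective module
(`not_isSocleAt_of_source`).

For `dom.dim ≤ d`: let the first `m + 1` terms of a minimal injective resolution be projective. They
are nonzero because an arrow into a sink prevents `B` from being self-injective. Lift a socle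
element of a term along the differential. Since the kernel is essential, the lift is not itself a
socle element, so a path of positive length takes it into the socle of the preceding term
(`IsSocleAt.exists_hasPosPath`). Iterating gives `m + 1` vertices, distinct by acyclicity, each in
the socle of a projective-injective module and hence of an indecomposable summand. -/

namespace QuiverAlg

/-! ### Maximal disjoint submodules and essential extensions -/

section Lattice

variable {A M : Type*} [Ring A] [AddCommGroup M] [Module A M]

/-- A submodule disjoint from `N` is contained in a maximal one. -/
theorem exists_maximal_disjoint (N L : Submodule A M) (h : Disjoint N L) :
    ∃ K, L ≤ K ∧ Disjoint N K ∧ ∀ K', K ≤ K' → Disjoint N K' → K' ≤ K := by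
  obtain ⟨K, hLK, hK⟩ := zorn_le_nonempty₀ {K : Submodule A M | Disjoint N K}
    (fun c hc hchain y hy => ⟨sSup c,
      hchain.directedOn.disjoint_sSup_right.2 fun _ hb => hc hb, fun z hz => le_sSup hz⟩) L h
  exact ⟨K, hLK, hK.prop, fun K' h1 h2 => hK.le_of_ge h2 h1⟩

end Lattice

universe u v

section Injective

variable {A : Type u} [Ring A]

/-- Every submodule of an injective module is essential in a direct summand. -/
theorem exists_isCompl_essential {M : Type v} [AddCommGroup M] [Module A M]
    [hM : Module.Injective A M] (N : Submodule A M) :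
    ∃ E K : Submodule A M, IsCompl E K ∧ N ≤ E ∧ ∀ L ≤ E, N ⊓ L = ⊥ → L = ⊥ := by
  obtain ⟨K, -, hNK, hK⟩ := exists_maximal_disjoint N ⊥ disjoint_bot_right
  obtain ⟨E, hNE, hKE, hE⟩ := exists_maximal_disjoint K N hNK.symm
  have hinj : Function.Injective (E.subtype.coprod K.subtype) := by
    rw [← LinearMap.ker_eq_bot, LinearMap.ker_coprod_of_disjoint_range]
    · simp
    · simpa using hKE.symm
  -- Injectivity extends the projection of `E ⊕ K` onto `E` to an endomorphism of `M`. The two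
  -- maximality properties then force its image to be `E`.
  obtain ⟨p, hp⟩ := hM.out _ hinj (E.subtype ∘ₗ LinearMap.fst A E K)
  have hpE : ∀ x ∈ E, p x = x := fun x hx => by simpa using hp (⟨x, hx⟩, 0)
  have hpK : ∀ x ∈ K, p x = 0 := fun x hx => by simpa using hp (0, ⟨x, hx⟩)
  have hcomap : K.comap p ≤ K := by
    refine hK _ (fun x hx => by simp [hpK x hx]) ?_
    rw [Submodule.disjoint_def]
    intro x hx hx'
    rw [Submodule.mem_comap, hpE x (hNE hx)] at hx'
    exact (Submodule.disjoint_def.1 hNK) x hx hx'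
  have hrange : LinearMap.range p ≤ E := by
    refine hE _ (fun x hx => ⟨x, hpE x hx⟩) ?_
    rw [Submodule.disjoint_def]
    rintro _ hx ⟨y, rfl⟩
    exact hpK _ (hcomap hx)
  have hcompl : IsCompl E K := by
    refine ⟨hKE.symm, codisjoint_iff.2 (eq_top_iff.2 fun x _ => ?_)⟩
    rw [Submodule.mem_sup]
    refine ⟨p x, hrange ⟨x, rfl⟩, x - p x, hcomap ?_, by abel⟩
    rw [Submodule.mem_comap, map_sub, hpE (p x) (hrange ⟨x, rfl⟩), sub_self]
    exact K.zero_mem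
  refine ⟨E, K, hcompl, hNE, fun L hLE hNL => ?_⟩
  -- If `L` avoids `N`, so does `L ⊔ K`, and maximality of `K` puts `L` inside `E ⊓ K`.
  have hLK : L ⊔ K ≤ K := by
    refine hK _ le_sup_right ?_
    rw [Submodule.disjoint_def]
    intro n hn hn'
    obtain ⟨l, hl, c, hc, rfl⟩ := Submodule.mem_sup.1 hn'
    have hc0 : c = 0 := Submodule.disjoint_def.1 hKE c hc (by
      have := E.sub_mem (hNE hn) (hLE hl)
      rwa [add_sub_cancel_left] at this)
    subst hc0
    rw [add_zero] at hn ⊢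
    exact (Submodule.mem_bot A).1 (hNL ▸ ⟨hn, hl⟩)
  exact eq_bot_iff.2 (hKE.symm hLE (le_sup_left.trans hLK))

/-- A retract of an injective module is injective. -/
theorem injective_of_retract {M N : Type v} [AddCommGroup M] [Module A M] [AddCommGroup N]
    [Module A N] [hM : Module.Injective A M] (i : N →ₗ[A] M) (r : M →ₗ[A] N)
    (hri : ∀ x, r (i x) = x) : Module.Injective A N where
  out X Y _ _ _ _ f hf g := by
    obtain ⟨h, hh⟩ := hM.out f hf (i ∘ₗ g)
    exact ⟨r ∘ₗ h, fun x => by simp [hh, hri]⟩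

/-- A linear map that is injective on an essential submodule is injective. -/
theorem IsEssential.ker_eq_bot {M N : Type v} [AddCommGroup M] [Module A M] [AddCommGroup N]
    [Module A N] {L : Submodule A M} (hL : IsEssential L) (f : M →ₗ[A] N)
    (hf : ∀ x ∈ L, f x = 0 → x = 0) : LinearMap.ker f = ⊥ := by
  refine hL _ (eq_bot_iff.2 ?_)
  rintro x ⟨hx, hx'⟩
  exact hf x hx hx'

end Injective

/-! ### Indecomposable injective modules -/

section Indecomposable

variable {A : Type u} [Ring A]

theorem eq_bot_or_eq_bot_of_indecomposable {M : ModuleCat.{v} A} (hM : Indecomposable M)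
    {E K : Submodule A M} (h : IsCompl E K) : E = ⊥ ∨ K = ⊥ := by
  have i : M ≅ ModuleCat.of A E ⊞ ModuleCat.of A K :=
    (Submodule.prodEquivOfIsCompl E K h).symm.toModuleIso ≪≫
      (ModuleCat.biprodIsoProd (ModuleCat.of A E) (ModuleCat.of A K)).symm
  rcases hM.2 _ _ i with h | h
  · exact Or.inl (Submodule.subsingleton_iff_eq_bot.1 (ModuleCat.subsingleton_of_isZero h))
  · exact Or.inr (Submodule.subsingleton_iff_eq_bot.1 (ModuleCat.subsingleton_of_isZero h))

/-- In a decomposition, the kernels of the two projections meet trivially, so one projection is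
injective and the other factor vanishes. -/
theorem indecomposable_of_uniform {M : ModuleCat.{v} A} [Nontrivial M]
    (hM : ∀ L L' : Submodule A M, L ⊓ L' = ⊥ → L = ⊥ ∨ L' = ⊥) : Indecomposable M := by
  refine ⟨fun h => not_subsingleton M (ModuleCat.subsingleton_of_isZero h), fun Y Z i => ?_⟩
  let e : M ≃ₗ[A] Y × Z := (i ≪≫ ModuleCat.biprodIsoProd Y Z).toLinearEquiv
  have hinf : LinearMap.ker (LinearMap.fst A Y Z ∘ₗ e.toLinearMap) ⊓
      LinearMap.ker (LinearMap.snd A Y Z ∘ₗ e.toLinearMap) = ⊥ := by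
    refine eq_bot_iff.2 ?_
    rintro x ⟨h1, h2⟩
    exact (Submodule.mem_bot A).2 (e.map_eq_zero_iff.1 (Prod.ext h1 h2))
  rcases hM _ _ hinf with h | h
  · right
    rw [ModuleCat.isZero_iff_subsingleton]
    refine subsingleton_of_forall_eq 0 fun z => ?_
    have : e.symm (0, z) ∈ (⊥ : Submodule A M) := h ▸ by simp
    simpa using this
  · left
    rw [ModuleCat.isZero_iff_subsingleton]
    refine subsingleton_of_forall_eq 0 fun z => ?_
    have : e.symm (z, 0) ∈ (⊥ : Submodule A M) := h ▸ by simp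
    simpa using this

theorem nontrivial_of_indecomposable {M : ModuleCat.{v} A} (hM : Indecomposable M) :
    Nontrivial M := by
  by_contra h
  rw [not_nontrivial_iff_subsingleton] at h
  exact hM.1 (ModuleCat.isZero_of_subsingleton M)

theorem isEssential_of_indecomposable {M : ModuleCat.{v} A} (hM : Indecomposable M)
    [Module.Injective A M] {N : Submodule A M} (hN : N ≠ ⊥) : IsEssential N := by
  obtain ⟨E, K, hEK, hNE, hess⟩ := exists_isCompl_essential N
  intro L hL
  rcases eq_bot_or_eq_bot_of_indecomposable hM hEK with rfl | rfl
  · exact absurd (le_bot_iff.1 hNE) hN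
  · have hE := hEK.sup_eq_top
    rw [sup_bot_eq] at hE
    exact hess L (hE ▸ le_top) hL

/-- Two indecomposable injective modules are isomorphic as soon as they have isomorphic nonzero
submodules. -/
theorem nonempty_iso_of_indecomposable {M M' : ModuleCat.{v} A} (hM : Indecomposable M)
    (hM' : Indecomposable M') [Module.Injective A M] [Module.Injective A M'] {X : Type v}
    [AddCommGroup X] [Module A X] [Nontrivial X] (i : X →ₗ[A] M) (hi : Function.Injective i)
    (g : X →ₗ[A] M') (hg : Function.Injective g) : Nonempty (M ≅ M') := by
  obtain ⟨f, hf⟩ := Module.Injective.out (Q := M') i hi g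
  have hN : LinearMap.range i ≠ ⊥ := by
    obtain ⟨x, hx⟩ := exists_ne (0 : X)
    intro h
    refine hx (hi ?_)
    rw [LinearMap.range_eq_bot.1 h, LinearMap.zero_apply, LinearMap.zero_apply]
  have hker : LinearMap.ker f = ⊥ := by
    refine IsEssential.ker_eq_bot (isEssential_of_indecomposable hM hN) f ?_
    rintro _ ⟨x, rfl⟩ hx
    rw [hf] at hx
    rw [hg (hx.trans (map_zero g).symm), map_zero]
  have hfinj := LinearMap.ker_eq_bot.1 hker
  -- Injectivity of `M` splits `f`, so its image is a nonzero summand of the indecomposable `M'`.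
  obtain ⟨r, hr⟩ := Module.Injective.out (Q := M) f hfinj LinearMap.id
  have hcompl : IsCompl (LinearMap.range f) (LinearMap.ker r) := by
    refine ⟨Submodule.disjoint_def.2 ?_, codisjoint_iff.2 (eq_top_iff.2 fun y _ => ?_)⟩
    · rintro _ ⟨x, rfl⟩ hx
      have h := hr x
      rw [LinearMap.mem_ker.1 hx, LinearMap.id_apply] at h
      rw [← h, map_zero]
    · refine Submodule.mem_sup.2 ⟨f (r y), ⟨r y, rfl⟩, y - f (r y), ?_, by abel⟩
      rw [LinearMap.mem_ker, map_sub, hr, LinearMap.id_apply, sub_self]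
  have hnt := nontrivial_of_indecomposable hM
  have htop : LinearMap.range f = ⊤ := by
    rcases eq_bot_or_eq_bot_of_indecomposable hM' hcompl with h | h
    · obtain ⟨x, hx⟩ := exists_ne (0 : M)
      refine absurd (hfinj ?_) hx
      rw [LinearMap.range_eq_bot.1 h, LinearMap.zero_apply, LinearMap.zero_apply]
    · have := hcompl.sup_eq_top
      rwa [h, sup_bot_eq] at this
  exact ⟨(LinearEquiv.ofBijective f ⟨hfinj, LinearMap.range_eq_top.1 htop⟩).toModuleIso⟩

end Indecomposable

/-! ### Reachability in acyclic quivers -/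

section PosPath

variable {V : Type*} [Quiver V]

/-- There is a path of positive length from `a` to `b`. -/
def HasPosPath (a b : V) : Prop :=
  ∃ p : Quiver.Path a b, 0 < p.length

theorem HasPosPath.trans {a b c : V} (h : HasPosPath a b) (h' : HasPosPath b c) :
    HasPosPath a c := by
  obtain ⟨p, hp⟩ := h
  obtain ⟨q, hq⟩ := h'
  exact ⟨p.comp q, by rw [Quiver.Path.length_comp]; omega⟩

theorem IsAcyclic.not_hasPosPath (h : IsAcyclic V) (a : V) : ¬ HasPosPath a a :=
  fun ⟨p, hp⟩ => hp.ne' (h a p)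

/-- In a finite acyclic quiver, every nonempty set of vertices has a vertex from which no other
one can be reached. -/
theorem IsAcyclic.exists_last [Finite V] (h : IsAcyclic V) (s : Set V) (hs : s.Nonempty) :
    ∃ a ∈ s, ∀ b ∈ s, ¬ HasPosPath a b := by
  have : IsTrans V (Function.swap HasPosPath) := ⟨fun _ _ _ h1 h2 => HasPosPath.trans h2 h1⟩
  have : Std.Irrefl (Function.swap (HasPosPath (V := V))) := ⟨h.not_hasPosPath⟩
  exact (Finite.wellFounded_of_trans_of_irrefl (Function.swap (HasPosPath (V := V)))).has_min s hs

/-- In a finite acyclic quiver, every nonempty set of vertices has a vertex which cannot be reached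
from any other one. -/
theorem IsAcyclic.exists_first [Finite V] (h : IsAcyclic V) (s : Set V) (hs : s.Nonempty) :
    ∃ a ∈ s, ∀ b ∈ s, ¬ HasPosPath b a := by
  have : IsTrans V HasPosPath := ⟨fun _ _ _ h1 h2 => HasPosPath.trans h1 h2⟩
  have : Std.Irrefl (HasPosPath (V := V)) := ⟨h.not_hasPosPath⟩
  exact (Finite.wellFounded_of_trans_of_irrefl (HasPosPath (V := V))).has_min s hs

theorem HasPosPath.exists_last_arrow {a b : V} (h : HasPosPath a b) :
    ∃ c, Nonempty (c ⟶ b) := by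
  obtain ⟨p, hp⟩ := h
  cases p with
  | nil => simp at hp
  | cons q e => exact ⟨_, ⟨e⟩⟩

theorem HasPosPath.of_arrow {a b : V} (e : a ⟶ b) : HasPosPath a b :=
  ⟨e.toPath, by simp⟩

/-- A last vertex among the targets of arrows is a sink, since a nontrivial path out of it would end
at another target. -/
theorem IsAcyclic.exists_arrow_to_sink [Finite V] (h : IsAcyclic V) {x y : V} (e : x ⟶ y) :
    ∃ (a b : V) (_ : a ⟶ b), ∀ c, ¬ HasPosPath b c := by
  obtain ⟨b, ⟨a, ⟨f⟩⟩, hb⟩ := h.exists_last {b | ∃ a, Nonempty (a ⟶ b)} ⟨y, x, ⟨e⟩⟩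
  exact ⟨a, b, f, fun c hc => hb c hc.exists_last_arrow hc⟩

theorem IsAcyclic.exists_arrow_from_source [Finite V] (h : IsAcyclic V) {x y : V} (e : x ⟶ y) :
    ∃ (a b : V) (_ : a ⟶ b), ∀ c, ¬ HasPosPath c a := by
  obtain ⟨a, ⟨b, ⟨f⟩⟩, ha⟩ := h.exists_first {a | ∃ b, Nonempty (a ⟶ b)} ⟨x, y, ⟨e⟩⟩
  refine ⟨a, b, f, fun c hc => ?_⟩
  obtain ⟨d, ⟨g⟩⟩ := hc.exists_last_arrow
  exact ha d ⟨a, ⟨g⟩⟩ (.of_arrow g)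

theorem IsConnected.exists_arrow (h : IsConnected V) (hne : ¬ IsPoint V) :
    ∃ a b : V, Nonempty (a ⟶ b) := by
  by_contra! hno
  refine hne ⟨?_, hno⟩
  obtain ⟨⟨v⟩, hsub⟩ := h
  rw [Nat.card_eq_one_iff_unique]
  refine ⟨⟨fun a b => ?_⟩, ⟨v⟩⟩
  obtain ⟨p⟩ := (Quiver.WeaklyConnectedComponent.eq a b).1 (Subsingleton.elim _ _)
  cases p with
  | nil => rfl
  | cons q e =>
    rcases e with e | e
    · exact ((hno _ _).false e).elim
    · exact ((hno _ _).false e).elim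

end PosPath

/-! ### Socle elements at a vertex -/

section Socle

open PathAlgebra

variable {k : Type*} [Field k] {V : Type*} [Quiver V] [Fintype V] {B : Type*} [Ring B]
  (π : PathAlgebra k V →+* B) {M N : Type*} [AddCommGroup M] [Module B M] [AddCommGroup N]
  [Module B N]

/-- For a module over a quotient of the path algebra: a nonzero element that is concentrated at the
vertex `a` and killed by all paths of positive length. It spans a simple submodule. -/
structure IsSocleAt (a : V) (x : M) : Prop where
  ne_zero : x ≠ 0
  nil_smul : π (ofPath k (Quiver.Path.nil : Quiver.Path a a)) • x = x
  path_smul : ∀ (b : V) (p : Quiver.Path a b), 0 < p.length → π (ofPath k p) • x = 0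

variable {π}

theorem path_smul_of_ne {a b c : V} {x : M}
    (hx : π (ofPath k (Quiver.Path.nil : Quiver.Path a a)) • x = x) (p : Quiver.Path b c)
    (h : b ≠ a) : π (ofPath k p) • x = 0 := by
  rw [← hx, ← mul_smul, ← map_mul, ofPath_mul_ofPath_of_ne _ _ h.symm, map_zero, zero_smul]

theorem nil_smul_path_smul {a b : V} (p : Quiver.Path a b) (x : M) :
    π (ofPath k (Quiver.Path.nil : Quiver.Path b b)) • π (ofPath k p) • x = π (ofPath k p) • x := by
  rw [← mul_smul, ← map_mul, ofPath_mul_ofPath, Quiver.Path.comp_nil]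

theorem algebraMap_smul_eq_zero {t : k} {x : M}
    (h : π (algebraMap k (PathAlgebra k V) t) • x = 0) (hx : x ≠ 0) : t = 0 := by
  by_contra ht
  apply hx
  have h2 := congrArg (fun y => π (algebraMap k (PathAlgebra k V) t⁻¹) • y) h
  simpa only [← mul_smul, ← map_mul, inv_mul_cancel₀ ht, map_one, one_smul, smul_zero] using h2

/-- All paths except the trivial one at `a` kill `x`, so only its coefficient acts: `Bx` is the line
`kx`. -/
theorem IsSocleAt.exists_smul_eq (hπ : Function.Surjective π) {a : V} {x : M}
    (hx : IsSocleAt π a x) (c : B) :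
    ∃ t : k, c • x = π (algebraMap k (PathAlgebra k V) t) • x := by
  obtain ⟨f, rfl⟩ := hπ c
  induction f using PathAlgebra.induction_on with
  | zero => exact ⟨0, by simp⟩
  | add f g hf hg =>
    obtain ⟨s, hs⟩ := hf
    obtain ⟨t, ht⟩ := hg
    exact ⟨s + t, by simp only [map_add, add_smul, hs, ht]⟩
  | smul r p =>
    rename_i b c
    rw [Algebra.smul_def, map_mul, mul_smul]
    by_cases hb : b = a
    · subst hb
      cases p with
      | nil => exact ⟨r, by rw [hx.nil_smul]⟩
      | cons q e => exact ⟨0, by rw [hx.path_smul _ _ (by simp)]; simp⟩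
    · exact ⟨0, by rw [path_smul_of_ne hx.nil_smul p hb]; simp⟩

theorem IsSocleAt.map {a : V} {x : M} (hx : IsSocleAt π a x) (f : M →ₗ[B] N) (hf : f x ≠ 0) :
    IsSocleAt π a (f x) where
  ne_zero := hf
  nil_smul := by rw [← map_smul, hx.nil_smul]
  path_smul b p hp := by rw [← map_smul, hx.path_smul b p hp, map_zero]

theorem IsSocleAt.of_map {a : V} {x : M} (f : M →ₗ[B] N) (hf : Function.Injective f)
    (hx : IsSocleAt π a (f x)) : IsSocleAt π a x where
  ne_zero h := hx.ne_zero (by rw [h, map_zero])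
  nil_smul := hf (by rw [map_smul, hx.nil_smul])
  path_smul b p hp := hf (by rw [map_smul, hx.path_smul b p hp, map_zero])

theorem IsSocleAt.prodMk {a : V} {x : M} {y : N} (hx : IsSocleAt π a x) (hy : IsSocleAt π a y) :
    IsSocleAt π a (x, y) where
  ne_zero h := hx.ne_zero (congrArg Prod.fst h)
  nil_smul := Prod.ext hx.nil_smul hy.nil_smul
  path_smul b p hp := Prod.ext (hx.path_smul b p hp) (hy.path_smul b p hp)

/-- The submodule generated by a socle element is simple. -/
theorem IsSocleAt.mem_span_singleton (hπ : Function.Surjective π) {a : V} {x y : M}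
    (hx : IsSocleAt π a x) (hy : y ∈ Submodule.span B {x}) (hy0 : y ≠ 0) :
    x ∈ Submodule.span B {y} := by
  obtain ⟨c, rfl⟩ := Submodule.mem_span_singleton.1 hy
  obtain ⟨t, ht⟩ := hx.exists_smul_eq hπ c
  rw [ht] at hy0 ⊢
  have ht0 : t ≠ 0 := by
    rintro rfl
    simp at hy0
  refine Submodule.mem_span_singleton.2 ⟨π (algebraMap k (PathAlgebra k V) t⁻¹), ?_⟩
  rw [← mul_smul, ← map_mul, ← map_mul, inv_mul_cancel₀ ht0, map_one, map_one, one_smul]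

theorem IsSocleAt.mem_of_inf_ne_bot (hπ : Function.Surjective π) {a : V} {x : M}
    (hx : IsSocleAt π a x) {L : Submodule B M} (hL : L ⊓ Submodule.span B {x} ≠ ⊥) : x ∈ L := by
  obtain ⟨y, ⟨hyL, hyx⟩, hy0⟩ := (Submodule.ne_bot_iff _).1 hL
  exact Submodule.span_le.2 (Set.singleton_subset_iff.2 hyL) (hx.mem_span_singleton hπ hyx hy0)

theorem IsSocleAt.span_ne_bot {a : V} {x : M} (hx : IsSocleAt π a x) :
    Submodule.span B {x} ≠ ⊥ :=
  fun h => hx.ne_zero (Submodule.span_singleton_eq_bot.1 h)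

theorem IsSocleAt.mem_of_isEssential (hπ : Function.Surjective π) {a : V} {x : M}
    (hx : IsSocleAt π a x) {L : Submodule B M} (hL : IsEssential L) : x ∈ L :=
  hx.mem_of_inf_ne_bot hπ fun h => hx.span_ne_bot (hL _ h)

theorem IsSocleAt.eq_of_mem_span (hπ : Function.Surjective π) {a b : V} {x y : M}
    (hx : IsSocleAt π a x) (hy : IsSocleAt π b y) (h : y ∈ Submodule.span B {x}) : a = b := by
  by_contra hab
  have hx' := hx.mem_span_singleton hπ h hy.ne_zero
  obtain ⟨c, hc⟩ := Submodule.mem_span_singleton.1 hx'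
  obtain ⟨t, ht⟩ := hy.exists_smul_eq hπ c
  apply hx.ne_zero
  rw [← hx.nil_smul, ← hc, ht, ← mul_smul, ← map_mul, ← Algebra.commutes, map_mul, mul_smul,
    path_smul_of_ne hy.nil_smul _ hab, smul_zero]

/-- The span of `(x, y)` is the graph of an isomorphism from `Bx` to `By`. Using it with both
projections avoids constructing that isomorphism. -/
theorem IsSocleAt.fst_injective (hπ : Function.Surjective π) {a : V} {x : M} {y : N}
    (hx : IsSocleAt π a x) (hy : IsSocleAt π a y) :
    Function.Injective (LinearMap.fst B M N ∘ₗ (Submodule.span B {(x, y)}).subtype) := by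
  rw [injective_iff_map_eq_zero]
  rintro ⟨z, hz⟩ h
  obtain ⟨c, rfl⟩ := Submodule.mem_span_singleton.1 hz
  obtain ⟨t, ht⟩ := (hx.prodMk hy).exists_smul_eq hπ c
  have h1 : (c • (x, y)).1 = 0 := h
  rw [ht, Prod.smul_fst] at h1
  have := algebraMap_smul_eq_zero h1 hx.ne_zero
  rw [Submodule.mk_eq_zero, ht, this, map_zero, map_zero, zero_smul]

theorem IsSocleAt.snd_injective (hπ : Function.Surjective π) {a : V} {x : M} {y : N}
    (hx : IsSocleAt π a x) (hy : IsSocleAt π a y) :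
    Function.Injective (LinearMap.snd B M N ∘ₗ (Submodule.span B {(x, y)}).subtype) := by
  rw [injective_iff_map_eq_zero]
  rintro ⟨z, hz⟩ h
  obtain ⟨c, rfl⟩ := Submodule.mem_span_singleton.1 hz
  obtain ⟨t, ht⟩ := (hx.prodMk hy).exists_smul_eq hπ c
  have h1 : (c • (x, y)).2 = 0 := h
  rw [ht, Prod.smul_snd] at h1
  have := algebraMap_smul_eq_zero h1 hy.ne_zero
  rw [Submodule.mk_eq_zero, ht, this, map_zero, map_zero, zero_smul]

/-- Every nonzero element concentrated at a vertex is moved into the socle by some path. -/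
theorem exists_path_isSocleAt (hV : IsAcyclic V) {a : V} {y : M}
    (hy : π (ofPath k (Quiver.Path.nil : Quiver.Path a a)) • y = y) (hy0 : y ≠ 0) :
    ∃ (b : V) (p : Quiver.Path a b), IsSocleAt π b (π (ofPath k p) • y) := by
  obtain ⟨b, ⟨p, hp⟩, hb⟩ := hV.exists_last
    {b | ∃ p : Quiver.Path a b, π (ofPath k p) • y ≠ 0} ⟨a, .nil, by rwa [hy]⟩
  refine ⟨b, p, hp, nil_smul_path_smul p y, fun c q hq => ?_⟩
  by_contra hne
  rw [← mul_smul, ← map_mul, ofPath_mul_ofPath] at hne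
  exact hb c ⟨p.comp q, hne⟩ ⟨q, hq⟩

/-- The trivial paths sum to `1`, so one of them does not kill a given nonzero element. -/
theorem exists_isSocleAt (π : PathAlgebra k V →+* B) (hV : IsAcyclic V) (M : Type*)
    [AddCommGroup M] [Module B M] [Nontrivial M] : ∃ (a : V) (x : M), IsSocleAt π a x := by
  obtain ⟨y, hy⟩ := exists_ne (0 : M)
  have h1 : ∑ a : V, π (ofPath k (Quiver.Path.nil : Quiver.Path a a)) • y = y := by
    rw [← Finset.sum_smul, ← map_sum, ← PathAlgebra.one_def, map_one, one_smul]
  obtain ⟨a, -, ha⟩ := Finset.exists_ne_zero_of_sum_ne_zero (h1.trans_ne hy)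
  obtain ⟨b, p, hp⟩ := exists_path_isSocleAt hV (nil_smul_path_smul _ y) ha
  exact ⟨b, _, hp⟩

/-- If the kernel and the range of a linear map are essential, then each vertex in the socle of
the target has a path of positive length to a vertex in the socle of the source. -/
theorem IsSocleAt.exists_hasPosPath (hV : IsAcyclic V) (hπ : Function.Surjective π) {a : V}
    {x : N} (hx : IsSocleAt π a x) (f : M →ₗ[B] N) (hker : IsEssential (LinearMap.ker f))
    (hrange : IsEssential (LinearMap.range f)) :
    ∃ (b : V) (y : M), IsSocleAt π b y ∧ HasPosPath a b := by
  obtain ⟨y, hy⟩ := hx.mem_of_isEssential hπ hrange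
  have hfz : f (π (ofPath k (Quiver.Path.nil : Quiver.Path a a)) • y) = x := by
    rw [map_smul, hy, hx.nil_smul]
  set z := π (ofPath k (Quiver.Path.nil : Quiver.Path a a)) • y with hz
  have hz1 : π (ofPath k (Quiver.Path.nil : Quiver.Path a a)) • z = z := nil_smul_path_smul _ y
  have hz0 : z ≠ 0 := by
    intro h
    rw [h, map_zero] at hfz
    exact hx.ne_zero hfz.symm
  obtain ⟨b, p, hp⟩ := exists_path_isSocleAt hV hz1 hz0
  refine ⟨b, _, hp, p, ?_⟩
  -- Were the path trivial, `z` would be a socle element, hence in the essential kernel,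
  -- contradicting `f z = x ≠ 0`.
  cases p with
  | nil =>
    rw [hz1] at hp
    have := hp.mem_of_isEssential hπ hker
    rw [LinearMap.mem_ker, hfz] at this
    exact (hx.ne_zero this).elim
  | cons q e => simp

end Socle

/-! ### Obstructions from sources and sinks -/

section SourceSink

open PathAlgebra

variable {k : Type*} [Field k] {V : Type*} [Quiver V] [Fintype V] {B : Type*} [Ring B]
  {π : PathAlgebra k V →+* B}

/-- A source that is not isolated does not occur in the socle of a projective module. -/
theorem not_isSocleAt_of_source (hπ : Function.Surjective π) {a b : V}
    (ha : ∀ c, ¬ HasPosPath c a) (e : a ⟶ b) (he : π (ofPath k e.toPath) ≠ 0) {M : Type*}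
    [AddCommGroup M] [Module B M] [Module.Projective B M] (x : M) : ¬ IsSocleAt π a x := by
  intro hx
  -- Embed the projective module in a free one; a nonzero coordinate reduces to a socle element of
  -- `B`.
  obtain ⟨s, hs⟩ := Module.projective_def'.1 ‹Module.Projective B M›
  have hsx : s x ≠ 0 := by
    intro h
    apply hx.ne_zero
    have := LinearMap.congr_fun hs x
    rw [LinearMap.comp_apply, h, map_zero] at this
    exact this.symm
  obtain ⟨i, hi⟩ := Finsupp.ne_iff.1 hsx
  have hy := hx.map (Finsupp.lapply i ∘ₗ s) hi
  generalize (Finsupp.lapply i ∘ₗ s) x = y at hy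
  -- Only the trivial path ends at the source `a`, so an element of `B` concentrated at `a` is a
  -- multiple of that path, which the arrow does not kill.
  have key : ∀ f : PathAlgebra k V, ∃ t : k,
      π (ofPath k (Quiver.Path.nil : Quiver.Path a a)) * π f =
        π (algebraMap k (PathAlgebra k V) t) *
          π (ofPath k (Quiver.Path.nil : Quiver.Path a a)) := by
    intro f
    induction f using PathAlgebra.induction_on with
    | zero => exact ⟨0, by simp⟩
    | add f g hf hg =>
      obtain ⟨s, hs⟩ := hf
      obtain ⟨t, ht⟩ := hg
      exact ⟨s + t, by simp only [map_add, add_mul, mul_add, hs, ht]⟩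
    | smul r p =>
      rename_i c d
      by_cases hd : d = a
      · subst hd
        cases p with
        | nil =>
          refine ⟨r, ?_⟩
          rw [Algebra.smul_def, ← map_mul, ← mul_assoc, ← Algebra.commutes, mul_assoc,
            ofPath_mul_ofPath, map_mul, Quiver.Path.comp_nil]
        | cons q g => exact (ha c ⟨q.cons g, by simp⟩).elim
      · refine ⟨0, ?_⟩
        rw [← map_mul, mul_smul_comm, ofPath_mul_ofPath_of_ne _ _ hd]
        simp
  obtain ⟨f, rfl⟩ := hπ y
  obtain ⟨t, ht⟩ := key f
  have h1 := hy.nil_smul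
  rw [smul_eq_mul, ht] at h1
  have h2 := hy.path_smul b e.toPath (by simp)
  rw [← h1, smul_eq_mul, ← mul_assoc, ← map_mul, ← Algebra.commutes, map_mul, mul_assoc,
    ← map_mul, ofPath_mul_ofPath, Quiver.Path.nil_comp] at h2
  rw [← smul_eq_mul] at h2
  have ht0 : t = 0 := algebraMap_smul_eq_zero h2 he
  apply hy.ne_zero
  rw [← h1, ht0, map_zero, map_zero, zero_mul]

/-- If there is an arrow into a sink, then the algebra is not self-injective. -/
theorem not_injective_of_sink (hV : IsAcyclic V) (hπ : Function.Surjective π) {a b : V}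
    (hb : ∀ c, ¬ HasPosPath b c) (e : a ⟶ b) (he : π (ofPath k e.toPath) ≠ 0)
    (he' : π (ofPath k (Quiver.Path.nil : Quiver.Path b b)) ≠ 0) : ¬ Module.Injective B B := by
  intro hB
  have h1 : IsSocleAt π b (π (ofPath k e.toPath)) :=
    ⟨he, by rw [smul_eq_mul, ← map_mul, ofPath_mul_ofPath, Quiver.Path.comp_nil],
      fun c p hp => (hb c ⟨p, hp⟩).elim⟩
  have h2 : IsSocleAt π b (π (ofPath k (Quiver.Path.nil : Quiver.Path b b))) :=
    ⟨he', by rw [smul_eq_mul, ← map_mul, ofPath_mul_ofPath, Quiver.Path.comp_nil],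
      fun c p hp => (hb c ⟨p, hp⟩).elim⟩
  let X := Submodule.span B
    {(π (ofPath k e.toPath), π (ofPath k (Quiver.Path.nil : Quiver.Path b b)))}
  -- The arrow and the trivial path at `b` span isomorphic simple left ideals. Self-injectivity
  -- would extend the isomorphism to a right multiplication carrying the arrow to the trivial path.
  obtain ⟨h, hh⟩ := hB.out (LinearMap.fst B B B ∘ₗ X.subtype) (h1.fst_injective hπ h2)
    (LinearMap.snd B B B ∘ₗ X.subtype)
  have h3 : h (π (ofPath k e.toPath)) = π (ofPath k (Quiver.Path.nil : Quiver.Path b b)) :=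
    hh ⟨(π (ofPath k e.toPath), π (ofPath k (Quiver.Path.nil : Quiver.Path b b))),
      Submodule.mem_span_singleton_self _⟩
  have hab : a ≠ b := by
    rintro rfl
    exact hV.not_hasPosPath a (.of_arrow e)
  -- A contributing path would have to run from the sink `b` to `a ≠ b`.
  have key : ∀ f : PathAlgebra k V, ofPath k e.toPath * f *
      ofPath k (Quiver.Path.nil : Quiver.Path b b) = 0 := by
    intro f
    induction f using PathAlgebra.induction_on with
    | zero => simp
    | add f g hf hg => rw [mul_add, add_mul, hf, hg, add_zero]
    | smul r p =>
      rename_i c d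
      rw [mul_smul_comm, smul_mul_assoc]
      by_cases hc : b = c
      · subst hc
        cases p with
        | nil => rw [ofPath_mul_ofPath_of_ne _ _ hab.symm, zero_mul, smul_zero]
        | cons q g => exact (hb d ⟨q.cons g, by simp⟩).elim
      · rw [mul_assoc, ofPath_mul_ofPath_of_ne _ _ hc, mul_zero, smul_zero]
  obtain ⟨f, hf⟩ := hπ (h 1)
  apply he'
  have h4 : π (ofPath k e.toPath) * h 1 = π (ofPath k (Quiver.Path.nil : Quiver.Path b b)) := by
    rw [← h3, ← smul_eq_mul, ← map_smul, smul_eq_mul, mul_one]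
  have h5 := congrArg π (key f)
  rwa [map_mul, map_mul, hf, h4, map_zero, ← map_mul, ofPath_mul_ofPath,
    Quiver.Path.comp_nil] at h5

end SourceSink

/-! ### Path length and admissible ideals -/

section Kernel

open PathAlgebra

variable {k : Type*} [Field k] {V : Type*} [Quiver V]

variable (k V) in
/-- The subspace of the path algebra spanned by the paths of length at least `n`. -/
noncomputable def longPaths (n : ℕ) : Submodule k (PathAlgebra k V) :=
  Submodule.span k (pathBasis k V '' {p | n ≤ p.2.2.length})

theorem ofPath_mem_longPaths {n : ℕ} {a b : V} {p : Quiver.Path a b} :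
    ofPath k p ∈ longPaths k V n ↔ n ≤ p.length := by
  refine ⟨fun h => ?_, fun h => Submodule.subset_span ⟨⟨a, b, p⟩, h, rfl⟩⟩
  by_contra hn
  exact (pathBasis k V).linearIndependent.notMem_span_image hn h

theorem mul_mem_longPaths [Fintype V] {m n : ℕ} {f g : PathAlgebra k V}
    (hf : f ∈ longPaths k V m) (hg : g ∈ longPaths k V n) : f * g ∈ longPaths k V (m + n) := by
  induction hf using Submodule.span_induction with
  | zero => rw [zero_mul]; exact zero_mem _
  | add f f' _ _ hf hf' => rw [add_mul]; exact add_mem hf hf'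
  | smul r f _ hf => rw [smul_mul_assoc]; exact Submodule.smul_mem _ _ hf
  | mem f hf =>
  induction hg using Submodule.span_induction with
  | zero => rw [mul_zero]; exact zero_mem _
  | add f f' _ _ hf hf' => rw [mul_add]; exact add_mem hf hf'
  | smul r f _ hf => rw [mul_smul_comm]; exact Submodule.smul_mem _ _ hf
  | mem g hg =>
  obtain ⟨⟨a, b, p⟩, hp, rfl⟩ := hf
  obtain ⟨⟨c, d, q⟩, hq, rfl⟩ := hg
  change ofPath k p * ofPath k q ∈ _
  by_cases h : d = a
  · subst h
    rw [ofPath_mul_ofPath, ofPath_mem_longPaths, Quiver.Path.length_comp]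
    simp only [Set.mem_ofPred_eq] at hp hq
    omega
  · rw [ofPath_mul_ofPath_of_ne _ _ h]
    exact zero_mem _

theorem mem_longPaths_zero (f : PathAlgebra k V) : f ∈ longPaths k V 0 := by
  induction f using PathAlgebra.induction_on with
  | zero => exact zero_mem _
  | add f g hf hg => exact add_mem hf hg
  | smul r p => exact Submodule.smul_mem _ _ (ofPath_mem_longPaths.2 (Nat.zero_le _))

variable [Fintype V]

/-- The paths of positive length span a two-sided ideal that contains the arrows. -/
theorem mem_longPaths_of_mem_arrowIdeal {f : PathAlgebra k V} (hf : f ∈ arrowIdeal k V) :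
    f ∈ longPaths k V 1 := by
  rw [arrowIdeal, TwoSidedIdeal.mem_asIdeal, TwoSidedIdeal.mem_span_iff] at hf
  have h := hf (TwoSidedIdeal.mk' (longPaths k V 1) (zero_mem _) add_mem neg_mem
    (fun {x y} hy => by simpa using mul_mem_longPaths (mem_longPaths_zero x) hy)
    (fun {x y} hx => by simpa using mul_mem_longPaths hx (mem_longPaths_zero y))) ?_
  · rwa [TwoSidedIdeal.mem_mk'] at h
  · rintro _ ⟨a, b, e, rfl⟩
    rw [SetLike.mem_coe, TwoSidedIdeal.mem_mk', SetLike.mem_coe, ofPath_mem_longPaths]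
    simp

theorem mem_longPaths_of_mem_arrowIdeal_sq {f : PathAlgebra k V}
    (hf : f ∈ arrowIdeal k V ^ 2) : f ∈ longPaths k V 2 := by
  rw [Submodule.pow_succ, Submodule.pow_one] at hf
  refine Submodule.mul_induction_on (C := fun g => g ∈ longPaths k V 2) hf (fun g hg h hh => ?_)
    fun _ _ => add_mem
  have hgh := mul_mem_longPaths (mem_longPaths_of_mem_arrowIdeal hg)
    (mem_longPaths_of_mem_arrowIdeal hh)
  exact hgh

/-- This keeps vertices and arrows nonzero in the quotient: `I` lies in the span of the paths of
length at least two, and paths are linearly independent. -/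
theorem IsAdmissible.ofPath_notMem {I : Ideal (PathAlgebra k V)} (hI : IsAdmissible I) {a b : V}
    (p : Quiver.Path a b) (hp : p.length ≤ 1) : ofPath k p ∉ I := by
  intro h
  have := ofPath_mem_longPaths.1 (mem_longPaths_of_mem_arrowIdeal_sq (hI.1 h))
  omega

end Kernel

/-! ### Nonvanishing terms of minimal injective resolutions -/

section Resolution

variable {A : Type u} [Ring A] {M : Type u} [AddCommGroup M] [Module A M]

theorem MinInjResolution.isEssential_ker (R : MinInjResolution A M) (j : ℕ) :
    IsEssential (LinearMap.ker (R.d j)) := by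
  cases j with
  | zero => rw [R.exact_zero.linearMap_ker_eq]; exact R.essential_zero
  | succ j => rw [(R.exact_succ j).linearMap_ker_eq]; exact R.essential_succ j

/-- A module that is not injective has no vanishing term in its minimal injective resolution as
long as the terms are projective. -/
theorem MinInjResolution.nontrivial (R : MinInjResolution A M) (hM : ¬ Module.Injective A M)
    {n : ℕ} (hproj : ∀ j < n, Module.Projective A (R.I j)) (j : ℕ) (hj : j < n) :
    Nontrivial (R.I j) := by
  induction j with
  | zero =>
    by_contra h
    rw [not_nontrivial_iff_subsingleton] at h
    have := R.injective 0
    exact hM (injective_of_retract R.ε 0 fun x => R.exact_left (Subsingleton.elim _ _))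
  | succ j ih =>
    by_contra h
    rw [not_nontrivial_iff_subsingleton] at h
    cases j with
    | zero =>
      have hsurj : Function.Surjective R.ε := fun y =>
        (R.exact_zero y).1 (Subsingleton.elim _ _)
      let e := LinearEquiv.ofBijective R.ε ⟨R.exact_left, hsurj⟩
      have := R.injective 0
      exact hM (injective_of_retract e.toLinearMap e.symm.toLinearMap fun x => by simp)
    | succ m =>
      have hsurj : Function.Surjective (R.d m) := fun y =>
        (R.exact_succ m y).1 (Subsingleton.elim _ _)
      have := hproj (m + 1) (by omega)
      -- If the next term vanishes, `R.d m` is onto a projective and splits. The image of a section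
      -- avoids the essential kernel, so it is zero, contradicting the inductive hypothesis.
      obtain ⟨s, hs⟩ := Module.projective_lifting_property (R.d m) LinearMap.id hsurj
      have hs' : ∀ y, R.d m (s y) = y := fun y => LinearMap.congr_fun hs y
      have hbot : LinearMap.range s = ⊥ := by
        refine R.isEssential_ker m _ (eq_bot_iff.2 ?_)
        rintro _ ⟨hx, y, rfl⟩
        rw [LinearMap.mem_ker.1 hx |>.symm.trans (hs' y) |>.symm, map_zero]
        exact zero_mem _
      have hnt := ih (by omega)
      obtain ⟨y, hy⟩ := exists_ne (0 : R.I (m + 1))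
      apply hy
      rw [← hs' y, LinearMap.range_eq_bot.1 hbot, LinearMap.zero_apply, map_zero]

end Resolution

/-! ### The two inequalities -/

section Main

variable {k : Type*} [Field k] {V : Type*} [Quiver V] [Fintype V] {B : Type u} [Ring B]
  {π : PathAlgebra k V →+* B}

/-- A socle element of a projective-injective module lies in an indecomposable summand. -/
theorem IsSocleAt.exists_indecomposable (hπ : Function.Surjective π) {M : ModuleCat.{v} B}
    [Module.Injective B M] [Module.Projective B M] {a : V} {x : M} (hx : IsSocleAt π a x) :
    ∃ E : ModuleCat.{v} B, Indecomposable E ∧ Module.Projective B E ∧ Module.Injective B E ∧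
      ∃ y : E, IsSocleAt π a y := by
  obtain ⟨E, K, hEK, hNE, hess⟩ := exists_isCompl_essential (Submodule.span B {x})
  let r : M →ₗ[B] E := E.projectionOnto K hEK
  have hr : ∀ y : E, r (E.subtype y) = y := fun y =>
    Submodule.projectionOnto_apply_left hEK y
  have hxE : x ∈ E := hNE (Submodule.mem_span_singleton_self x)
  have hy : IsSocleAt π a (⟨x, hxE⟩ : E) :=
    IsSocleAt.of_map E.subtype E.subtype_injective hx
  -- `E` is an essential extension of the simple module `Bx`, so every nonzero submodule contains
  -- `x`; hence `E` is uniform.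
  have hmem : ∀ L : Submodule B E, L ≠ ⊥ → (⟨x, hxE⟩ : E) ∈ L := by
    intro L hL
    have hne : Submodule.span B {x} ⊓ L.map E.subtype ≠ ⊥ := fun h =>
      hL (Submodule.map_injective_of_injective E.subtype_injective
        ((hess _ (Submodule.map_subtype_le E L) h).trans (Submodule.map_bot _).symm))
    rw [inf_comm] at hne
    obtain ⟨y, hyL, hyx⟩ := hx.mem_of_inf_ne_bot hπ hne
    rwa [show (⟨x, hxE⟩ : E) = y from Subtype.ext hyx.symm]
  have : Nontrivial (ModuleCat.of B E) := ⟨⟨_, _, hy.ne_zero⟩⟩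
  refine ⟨ModuleCat.of B E, indecomposable_of_uniform fun L L' h => ?_,
    Module.Projective.of_split E.subtype r (LinearMap.ext hr),
    injective_of_retract E.subtype r hr, _, hy⟩
  by_contra! hL
  have hmem' : (⟨x, hxE⟩ : E) ∈ L ⊓ L' := ⟨hmem L hL.1, hmem L' hL.2⟩
  rw [h] at hmem'
  exact hy.ne_zero ((Submodule.mem_bot B).1 hmem')

theorem IsSocleAt.unique (hπ : Function.Surjective π) {M : ModuleCat.{v} B}
    (hM : Indecomposable M) [Module.Injective B M] {a b : V} {x y : M} (hx : IsSocleAt π a x)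
    (hy : IsSocleAt π b y) : a = b :=
  hx.eq_of_mem_span hπ hy
    (hy.mem_of_isEssential hπ (isEssential_of_indecomposable hM hx.span_ne_bot))

theorem IsSocleAt.nonempty_iso (hπ : Function.Surjective π) {M M' : ModuleCat.{v} B}
    (hM : Indecomposable M) (hM' : Indecomposable M') [Module.Injective B M]
    [Module.Injective B M'] {a : V} {x : M} {y : M'} (hx : IsSocleAt π a x)
    (hy : IsSocleAt π a y) : Nonempty (M ≅ M') := by
  have : Nontrivial (Submodule.span B {(x, y)}) :=
    (Submodule.nontrivial_iff_ne_bot).2 (hx.prodMk hy).span_ne_bot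
  exact nonempty_iso_of_indecomposable hM hM'
    (LinearMap.fst B M M' ∘ₗ (Submodule.span B {(x, y)}).subtype) (hx.fst_injective hπ hy)
    (LinearMap.snd B M M' ∘ₗ (Submodule.span B {(x, y)}).subtype) (hx.snd_injective hπ hy)

/-- A vertex in the socle of a term of a minimal injective resolution starts a descending chain of
vertices in the socles of the preceding terms. -/
theorem MinInjResolution.exists_chain (hV : IsAcyclic V) (hπ : Function.Surjective π) {M : Type u}
    [AddCommGroup M] [Module B M] (R : MinInjResolution B M) (m : ℕ) (a : V) (x : R.I m)
    (hx : IsSocleAt π a x) : ∃ c : ℕ → V, c m = a ∧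
      (∀ j ≤ m, ∃ y : R.I j, IsSocleAt π (c j) y) ∧
        ∀ i j, i < j → j ≤ m → HasPosPath (c j) (c i) := by
  induction m generalizing a with
  | zero =>
    refine ⟨fun _ => a, rfl, fun j hj => ?_, fun i j hij hj => by omega⟩
    obtain rfl : j = 0 := by omega
    exact ⟨x, hx⟩
  | succ m ih =>
    obtain ⟨b, y, hy, hab⟩ :=
      hx.exists_hasPosPath hV hπ (R.d m) (R.isEssential_ker m) (R.essential_succ m)
    obtain ⟨c, hcm, hc, hpos⟩ := ih b y hy
    refine ⟨fun j => if j = m + 1 then a else c j, by simp, fun j hj => ?_, fun i j hij hj => ?_⟩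
    · by_cases h : j = m + 1
      · subst h
        exact ⟨x, by simpa using hx⟩
      · simpa only [if_neg h] using hc j (by omega)
    · have hi : i ≠ m + 1 := by omega
      simp only [if_neg hi]
      by_cases h : j = m + 1
      · rw [if_pos h]
        rcases Nat.lt_or_ge i m with him | him
        · exact hab.trans (hcm ▸ hpos i m him le_rfl)
        · obtain rfl : i = m := by omega
          rwa [hcm]
      · rw [if_neg h]
        exact hpos i j hij (by omega)

theorem domDim_le_numProjInj (hV : IsAcyclic V) (hπ : Function.Surjective π)
    (hB : ¬ Module.Injective B B) : domDim B ≤ numProjInj B := by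
  refine iSup_le ?_
  rintro ⟨n, R, hR⟩
  rcases n with - | m
  · simp
  -- With `n = m + 1` the last projective term has index `m`, so the chain starting there has `n`
  -- vertices.
  have := R.nontrivial hB hR m (Nat.lt_succ_self m)
  obtain ⟨a, x, hx⟩ := exists_isSocleAt π hV (R.I m)
  obtain ⟨c, -, hc, hpos⟩ := R.exists_chain hV hπ m a x hx
  have key : ∀ j : Fin (m + 1), ∃ E : ModuleCat.{u} B, Indecomposable E ∧
      Module.Projective B E ∧ Module.Injective B E ∧ ∃ y : E, IsSocleAt π (c j) y := by
    intro j
    obtain ⟨y, hy⟩ := hc j (Nat.lt_succ_iff.1 j.2)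
    have := R.injective j
    have := hR j j.2
    exact hy.exists_indecomposable hπ
  choose E hE hEp hEi y hy using key
  let F : Fin (m + 1) → Quotient (isIsomorphicSetoid (ModuleCat.{u} B)) :=
    fun j => Quotient.mk _ (E j)
  have hne : ∀ i j : Fin (m + 1), i < j → F i ≠ F j := by
    intro i j hij h
    obtain ⟨e⟩ : Nonempty (E i ≅ E j) := Quotient.exact h
    have hz := (hy i).map e.toLinearEquiv.toLinearMap
      ((e.toLinearEquiv.map_ne_zero_iff).2 (hy i).ne_zero)
    have hij' := hpos i j hij (Nat.lt_succ_iff.1 j.2)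
    have := hEi j
    rw [hz.unique hπ (hE j) (hy j)] at hij'
    exact hV.not_hasPosPath _ hij'
  have hF : Function.Injective F := by
    intro i j h
    by_contra hij
    rcases lt_or_gt_of_ne hij with hij | hij
    · exact hne i j hij h
    · exact hne j i hij h.symm
  calc ((m + 1 : ℕ) : ℕ∞) = (Set.range F).encard := by
        rw [← Set.image_univ, hF.encard_image, Set.encard_univ, ENat.card_eq_coe_fintype_card,
          Fintype.card_fin]
    _ ≤ numProjInj B := Set.encard_le_encard (by
        rintro _ ⟨j, rfl⟩
        exact ⟨E j, rfl, hE j, hEp j, hEi j⟩)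

/-- Choosing a socle vertex is injective on isomorphism classes and misses `a`. As `a` exists, the
subtraction is not truncated. -/
theorem numProjInj_le (hV : IsAcyclic V) (hπ : Function.Surjective π) {a : V}
    (ha : ∀ (M : ModuleCat.{u} B) [Module.Projective B M] (x : M), ¬ IsSocleAt π a x) :
    numProjInj B ≤ ((Fintype.card V - 1 : ℕ) : ℕ∞) := by
  set S := {c : Quotient (isIsomorphicSetoid (ModuleCat.{u} B)) |
    ∃ M : ModuleCat.{u} B, c = Quotient.mk _ M ∧
      Indecomposable M ∧ Module.Projective B M ∧ Module.Injective B M} with hS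
  have key : ∀ c : S, ∃ M : ModuleCat.{u} B, c.1 = Quotient.mk _ M ∧
      Indecomposable M ∧ Module.Projective B M ∧ Module.Injective B M ∧
        ∃ (b : V) (x : M), IsSocleAt π b x := by
    rintro ⟨c, M, h, hM, hMp, hMi⟩
    have := nontrivial_of_indecomposable hM
    exact ⟨M, h, hM, hMp, hMi, exists_isSocleAt π hV M⟩
  choose M hM hMind hMp hMi b x hx using key
  have hb : Function.Injective b := by
    intro c c' h
    have := hMi c
    have := hMi c'
    obtain ⟨e⟩ := (hx c).nonempty_iso hπ (hMind c) (hMind c') (h ▸ hx c')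
    have hq : (Quotient.mk (isIsomorphicSetoid (ModuleCat.{u} B)) (M c)) = Quotient.mk _ (M c') :=
      Quotient.sound (show IsIsomorphic _ _ from ⟨e⟩)
    exact Subtype.ext ((hM c).trans (hq.trans (hM c').symm))
  classical
  have hrange : Set.range b ⊆ ((Finset.univ.erase a : Finset V) : Set V) := by
    rintro _ ⟨c, rfl⟩
    rw [Finset.mem_coe, Finset.mem_erase]
    refine ⟨fun h => ?_, Finset.mem_univ _⟩
    have := hMp c
    exact ha (M c) (x c) (h ▸ hx c)
  calc numProjInj B = (Set.range b).encard := by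
        rw [← Set.image_univ, hb.encard_image, Set.encard_univ]
        rfl
    _ ≤ ((Finset.univ.erase a : Finset V) : Set V).encard := Set.encard_le_encard hrange
    _ = ((Fintype.card V - 1 : ℕ) : ℕ∞) := by
        rw [Set.encard_coe_eq_coe_finsetCard, Finset.card_erase_of_mem (Finset.mem_univ a),
          Finset.card_univ]

end Main

end QuiverAlg

theorem mainTheorem3 {k : Type*} [Field k] {V : Type*} [Quiver V] [Fintype V]
    [∀ a b : V, Finite (a ⟶ b)]
    (hconn : QuiverAlg.IsConnected V) (hacyc : QuiverAlg.IsAcyclic V)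
    (hne : ¬ QuiverAlg.IsPoint V)
    (I : Ideal (QuiverAlg.PathAlgebra k V)) [I.IsTwoSided] (hI : QuiverAlg.IsAdmissible I) :
    QuiverAlg.domDim (QuiverAlg.PathAlgebra k V ⧸ I) ≤
        QuiverAlg.numProjInj (QuiverAlg.PathAlgebra k V ⧸ I) ∧
      QuiverAlg.numProjInj (QuiverAlg.PathAlgebra k V ⧸ I) ≤ ((Fintype.card V - 1 : ℕ) : ℕ∞) := by
  obtain ⟨x, y, ⟨e⟩⟩ := hconn.exists_arrow hne
  have hπ : Function.Surjective (Ideal.Quotient.mk I) := Ideal.Quotient.mk_surjective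
  have hpath {a b : V} (p : Quiver.Path a b) (hp : p.length ≤ 1) :
      Ideal.Quotient.mk I (QuiverAlg.PathAlgebra.ofPath k p) ≠ 0 := fun h =>
    hI.ofPath_notMem p hp (Ideal.Quotient.eq_zero_iff_mem.1 h)
  constructor
  · obtain ⟨a, b, f, hb⟩ := hacyc.exists_arrow_to_sink e
    exact QuiverAlg.domDim_le_numProjInj hacyc hπ (QuiverAlg.not_injective_of_sink hacyc hπ hb f
      (hpath _ (by simp)) (hpath _ (by simp)))
  · obtain ⟨a, b, f, ha⟩ := hacyc.exists_arrow_from_source e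
    exact QuiverAlg.numProjInj_le hacyc hπ fun M _ x =>
      QuiverAlg.not_isSocleAt_of_source hπ ha f (hpath _ (by simp)) x
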